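/- A semigroup $S$ is called \emph{3-nilpotent} if it has a zero element $0$, satisfies $abc=0$ for all $a,b,c\in S$, and has elements $a,b$ with $ab\neq 0$. It is called \emph{semirigid} if every automorphism of $S$ fixes every element of $S^2=\{ab : a,b\in S\}$. Let $\left\{{m\atop k}\right\}$ denote the Stirling number of the second kind. For a partition $\lambda=(\lambda_1,\dots,\lambda_s)$ of a positive integer $r$ (written $\lambda\vdash r$), put $\beta(\lambda)=\sum_{1\le i,j\le s}\gcd(\lambda_i,\lambda_j)$ and $w(\lambda)=\prod_{a} a^{\mu_a}\,\mu_a!$, where $a$ runs over the distinct parts of $\lambda$ and $\mu_a$ is the multiplicity of $a$ in $\lambda$ (so $w(\lambda)$ is the order of the centraliser in the symmetric group $\mathbb{S}_r$ of a permutation of cycle type $\lambda$). For every natural number $n$, the number of isomorphism classes of semirigid 3-nilpotent semigroups of order $n$ is at most $$\sum_{r=1}^{n-2}\ \sum_{\lambda\vdash r}\ \frac{1}{w(\lambda)}\left\{{\beta(\lambda)+1\atop n-r}\right\},$$ and the number of isomorphism classes of all 3-nilpotent semigroups of order $n$ is at least this same quantity. (For $n\le 2$ the sum is empty, hence $0$.)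 -/

import Mathlib

/-- The set `S²` of all products of two elements of `S`. -/
def productSet (S : Type*) [Semigroup S] : Set S :=
  Set.range fun p : S × S => p.1 * p.2

/-- `S` is 3-nilpotent (in the strict sense): it has a zero element `z`, satisfies `abc = z`
identically, and some product `ab` differs from `z`. -/
def IsThreeNilpotent (S : Type*) [Semigroup S] : Prop :=
  ∃ z : S, (∀ a : S, z * a = z ∧ a * z = z) ∧ (∀ a b c : S, a * b * c = z) ∧
    ∃ a b : S, a * b ≠ z

/-- `S` is semirigid: every automorphism of `S` fixes every element of `S²`. -/
def IsSemirigid (S : Type*) [Semigroup S] : Prop :=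
  ∀ φ : S ≃* S, ∀ s ∈ productSet S, φ s = s

/-- Isomorphism of semigroups, on the semigroup structures on `Fin n` with a property `P`. -/
def isoSetoid (n : ℕ) (P : Semigroup (Fin n) → Prop) :
    Setoid {S : Semigroup (Fin n) // P S} where
  r S T := Nonempty (@MulEquiv (Fin n) (Fin n) S.1.toMul T.1.toMul)
  iseqv :=
    { refl := fun S => ⟨@MulEquiv.refl (Fin n) S.1.toMul⟩
      symm := fun {S T} ⟨e⟩ => ⟨@MulEquiv.symm (Fin n) (Fin n) S.1.toMul T.1.toMul e⟩
      trans := fun {S T U} ⟨e⟩ ⟨f⟩ =>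
        ⟨@MulEquiv.trans (Fin n) (Fin n) (Fin n) S.1.toMul T.1.toMul U.1.toMul e f⟩ }

/-- There are finitely many semigroup structures on `Fin n`, so the cardinals below are those of
finite sets. -/
instance finite_semigroup_fin (n : ℕ) : Finite (Semigroup (Fin n)) :=
  Finite.of_injective
    (fun (S : Semigroup (Fin n)) (a b : Fin n) => S.mul a b)
    (fun S T h => Semigroup.ext (by
      funext a b
      exact congrFun (congrFun h a) b))

/-- The number of isomorphism classes of 3-nilpotent semigroups of order `n`. -/
noncomputable def numThreeNilpotent (n : ℕ) : ℕ :=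
  Nat.card (Quotient (isoSetoid n fun S => @IsThreeNilpotent (Fin n) S))

/-- The number of isomorphism classes of semirigid 3-nilpotent semigroups of order `n`. -/
noncomputable def numSemirigidThreeNilpotent (n : ℕ) : ℕ :=
  Nat.card (Quotient (isoSetoid n fun S =>
    @IsThreeNilpotent (Fin n) S ∧ @IsSemirigid (Fin n) S))

/-- `β(λ) = ∑ gcd(λᵢ, λⱼ)`, over all ordered pairs of parts of `λ` (parts listed with
multiplicity, `i = j` included). -/
def partitionBeta {r : ℕ} (l : r.Partition) : ℕ :=
  (l.parts.map fun a => (l.parts.map fun b => Nat.gcd a b).sum).sum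

/-- `w(λ) = ∏ aᵐ m!`, over the distinct parts `a` of `λ`, where `m` is the multiplicity of `a`. -/
def partitionWeight {r : ℕ} (l : r.Partition) : ℕ :=
  ∏ a ∈ l.parts.toFinset, a ^ l.parts.count a * (l.parts.count a).factorial

/-! Let M be the number of pairs (g, S) where S is a 3-nilpotent semigroup on `Fin n` and g is an
automorphism of S fixing S² pointwise. By Burnside's lemma (`card_isoSetoid_mul_factorial`), n!
times a number of isomorphism classes counts the pairs (g, S) with g any automorphism. When S is
semirigid every such pair is counted by M, and M counts only such pairs, so M / n! lies between the
two numbers of classes.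

It remains to compute M (`card_fixesProducts`). Let A be the complement of S², with r elements. Then
g is the identity off A and restricts to a permutation σ of A. A product with a factor outside A is
zero, so S amounts to a zero and a map from A × A to the complement of A that is constant on the
orbits of σ on pairs. Together they form a surjection from the orbits plus one extra point (sent to
the zero) onto the n - r elements of S². If σ has cycle type λ there are β(λ) orbits on pairs, hence
(n - r)! S(β(λ) + 1, n - r) surjections. Summing over σ replaces each λ by r! / w(λ) permutations,
and the binomial(n, r) choices of A turn r! (n - r)! into n!. -/

/-! ### Surjections and Stirling numbers. -/

/-- A function on `Option α` is surjective exactly when its restriction to `α` hits everything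
except possibly the value at `none`; the two cases are whether it also hits that value. -/
theorem card_surjective_option (α β : Type*) [Finite α] [Finite β] :
    Nat.card {f : Option α → β // Function.Surjective f} =
      ∑ᶠ b : β, (Nat.card {f : α → β // Function.Surjective f} +
        Nat.card {f : α → {x : β // x ≠ b} // Function.Surjective f}) := by
  classical
  have := Fintype.ofFinite β
  let F : (Σ b : β, ({f : α → β // Function.Surjective f} ⊕
      {f : α → {x : β // x ≠ b} // Function.Surjective f})) →
      {f : Option α → β // Function.Surjective f} := fun p =>
    match p with
    | ⟨b, .inl f⟩ => ⟨fun o => o.elim b f.1, fun y => by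
        obtain ⟨x, hx⟩ := f.2 y
        exact ⟨some x, hx⟩⟩
    | ⟨b, .inr f⟩ => ⟨fun o => o.elim b fun x => (f.1 x).1, fun y => by
        by_cases hy : y = b
        · exact ⟨none, hy.symm⟩
        · obtain ⟨x, hx⟩ := f.2 ⟨y, hy⟩
          exact ⟨some x, by simp [hx]⟩⟩
  have hF : Function.Bijective F := by
    constructor
    · rintro ⟨b, f | f⟩ ⟨c, g | g⟩ h
      · have h1 := congrArg Subtype.val h
        obtain rfl : b = c := congrFun h1 none
        obtain rfl : f = g := Subtype.ext (funext fun x => congrFun h1 (some x))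
        rfl
      · have h1 := congrArg Subtype.val h
        obtain rfl : b = c := congrFun h1 none
        obtain ⟨x, hx⟩ := f.2 b
        exact absurd ((congrFun h1 (some x)).symm.trans hx) (g.1 x).2
      · have h1 := congrArg Subtype.val h
        obtain rfl : b = c := congrFun h1 none
        obtain ⟨x, hx⟩ := g.2 b
        exact absurd ((congrFun h1 (some x)).trans hx) (f.1 x).2
      · have h1 := congrArg Subtype.val h
        obtain rfl : b = c := congrFun h1 none
        obtain rfl : f = g :=
          Subtype.ext (funext fun x => Subtype.ext (congrFun h1 (some x)))
        rfl
    · rintro ⟨f, hf⟩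
      by_cases h : ∃ x, f (some x) = f none
      · refine ⟨⟨f none, .inl ⟨fun x => f (some x), fun y => ?_⟩⟩, ?_⟩
        · obtain ⟨_ | x, hx⟩ := hf y
          · obtain ⟨z, hz⟩ := h
            exact ⟨z, hz.trans hx⟩
          · exact ⟨x, hx⟩
        · exact Subtype.ext (funext fun o => by cases o <;> rfl)
      · push Not at h
        refine ⟨⟨f none, .inr ⟨fun x => ⟨f (some x), h x⟩, fun y => ?_⟩⟩, ?_⟩
        · obtain ⟨_ | x, hx⟩ := hf y.1
          · exact absurd hx.symm y.2
          · exact ⟨x, Subtype.ext hx⟩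
        · exact Subtype.ext (funext fun o => by cases o <;> rfl)
  rw [← Nat.card_eq_of_bijective F hF, Nat.card_sigma, finsum_eq_sum_of_fintype]
  exact Finset.sum_congr rfl fun b _ => Nat.card_sum

/-- The number of surjections between finite types in terms of Stirling numbers. -/
theorem card_surjective (α : Type) [Finite α] : ∀ (β : Type) [Finite β],
    Nat.card {f : α → β // Function.Surjective f} =
      (Nat.card β).factorial * Nat.stirlingSecond (Nat.card α) (Nat.card β) := by
  induction α using Finite.induction_empty_option with
  | of_equiv e ih =>
    intro β _
    rw [← Nat.card_congr e, ← ih β]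
    exact Nat.card_congr ((e.arrowCongr (Equiv.refl β)).subtypeEquiv fun f => by
      simp [Equiv.arrowCongr, Function.comp_def]
      exact (e.symm.surjective_comp f).symm).symm
  | h_empty =>
    intro β _
    rcases isEmpty_or_nonempty β with h | h
    · have : Nonempty {f : PEmpty → β // Function.Surjective f} :=
        ⟨⟨PEmpty.elim, fun y => h.elim y⟩⟩
      rw [Nat.card_unique]
      simp
    · have : IsEmpty {f : PEmpty → β // Function.Surjective f} :=
        ⟨fun f => (f.2 (Classical.arbitrary β)).elim fun x _ => x.elim⟩
      obtain ⟨k, hk⟩ := Nat.exists_eq_succ_of_ne_zero (Nat.card_pos (α := β)).ne'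
      rw [Nat.card_of_isEmpty, hk, Nat.card_of_isEmpty, Nat.stirlingSecond_zero_succ, mul_zero]
  | h_option ih =>
    rename_i α _
    intro β _
    have := Fintype.ofFinite β
    classical
    rw [card_surjective_option, finsum_eq_sum_of_fintype]
    rcases hk : Nat.card β with _ | k
    · have := (Nat.card_eq_zero.1 hk).resolve_right (fun h => h.not_finite inferInstance)
      simp
    · have h1 : ∀ b : β, Nat.card {x : β // x ≠ b} = k := fun b => by
        rw [Nat.card_eq_fintype_card] at hk ⊢
        rw [Fintype.card_subtype_compl, hk, Fintype.card_subtype_eq, Nat.add_sub_cancel]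
      -- What remains is the recursion S(m+1, k+1) = (k+1) S(m, k+1) + S(m, k), multiplied by
      -- (k+1)!.
      simp only [ih, h1, hk, Finset.sum_const, Finset.card_univ, Finite.card_option,
        Nat.stirlingSecond_succ_succ, smul_eq_mul, ← Nat.card_eq_fintype_card,
        Nat.factorial_succ]
      ring

/-! ### Cycle lengths and the orbits of a permutation on pairs. -/

open Function in
theorem Equiv.Perm.IsCycleOn.minimalPeriod_eq {α : Type*} {σ : Equiv.Perm α} {s : Finset α}
    (hs : σ.IsCycleOn s) {x : α} (hx : x ∈ s) : minimalPeriod σ x = s.card := by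
  refine Nat.dvd_antisymm ?_ ?_
  · apply IsPeriodicPt.minimalPeriod_dvd
    rw [IsPeriodicPt, IsFixedPt, Equiv.Perm.iterate_eq_pow]
    exact hs.pow_card_apply hx
  · rw [← hs.pow_apply_eq hx, ← Equiv.Perm.iterate_eq_pow]
    exact isPeriodicPt_minimalPeriod σ x

-- Every point of an orbit has the orbit's size as its minimal period, so the reciprocals over one
-- orbit add up to 1.
open Function in
theorem Equiv.Perm.card_sameCycle_quotient {α : Type*} [Fintype α] (σ : Equiv.Perm α) :
    (Nat.card (Quotient (Equiv.Perm.SameCycle.setoid σ)) : ℚ) =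
      ∑ x, (minimalPeriod σ x : ℚ)⁻¹ := by
  classical
  have := Fintype.ofFinite (Quotient (Equiv.Perm.SameCycle.setoid σ))
  rw [Nat.card_eq_fintype_card, ← Finset.sum_fiberwise_of_maps_to
    (g := fun x => (Quotient.mk (Equiv.Perm.SameCycle.setoid σ) x)) (t := Finset.univ)
    fun x _ => Finset.mem_univ _]
  rw [Finset.sum_congr rfl (g := fun _ => (1 : ℚ)), Finset.sum_const, Finset.card_univ,
    nsmul_eq_mul, mul_one]
  rintro ⟨x⟩ -
  set s : Finset α := Finset.univ.filter fun y =>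
    Quotient.mk (Equiv.Perm.SameCycle.setoid σ) y = Quotient.mk _ x
  have hmem : ∀ y, y ∈ s ↔ σ.SameCycle y x := fun y => by
    simp only [s, Finset.mem_filter, Finset.mem_univ, true_and]
    exact Quotient.eq
  have hs : σ.IsCycleOn s := by
    refine ⟨⟨fun y hy => ?_, σ.injective.injOn, fun y hy => ⟨σ.symm y, ?_, by simp⟩⟩,
      fun y hy z hz => ?_⟩
    · simpa [hmem] using hy
    · rw [Finset.mem_coe, hmem] at hy ⊢
      rw [← Equiv.Perm.sameCycle_apply_left]
      simpa using hy
    · rw [Finset.mem_coe, hmem] at hy hz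
      exact hy.trans hz.symm
  have hx : x ∈ s := (hmem x).2 (Equiv.Perm.SameCycle.refl _ _)
  have hs0 : (s.card : ℚ) ≠ 0 := by exact_mod_cast (Finset.card_pos.2 ⟨x, hx⟩).ne'
  change ∑ y ∈ s, _ = _
  rw [Finset.sum_congr rfl fun y hy => by rw [hs.minimalPeriod_eq hy], Finset.sum_const,
    nsmul_eq_mul, mul_inv_cancel₀ hs0]

open Function in
/-- A sum over the cycle lengths of `σ` as a sum over points. -/
theorem Equiv.Perm.sum_parts_partition {α : Type*} [Fintype α] [DecidableEq α]
    (σ : Equiv.Perm α) (f : ℕ → ℚ) :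
    (σ.partition.parts.map f).sum = ∑ x, f (minimalPeriod σ x) / minimalPeriod σ x := by
  have hsupp : ∑ x ∈ σ.support, f (minimalPeriod σ x) / minimalPeriod σ x =
      (σ.cycleType.map f).sum := by
    rw [← Finset.sum_fiberwise_of_maps_to (g := fun x => σ.cycleOf x)
      (t := σ.cycleFactorsFinset) fun x hx => by
        simpa [Equiv.Perm.cycleOf_mem_cycleFactorsFinset_iff] using hx]
    rw [Equiv.Perm.cycleType_def, Multiset.map_map]
    refine Finset.sum_congr rfl fun c hc => ?_
    have hc' := Equiv.Perm.mem_cycleFactorsFinset_iff.1 hc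
    have hset : σ.support.filter (fun x => σ.cycleOf x = c) = c.support := by
      ext x
      simp only [Finset.mem_filter]
      constructor
      · rintro ⟨hx, rfl⟩
        exact (Equiv.Perm.mem_support_cycleOf_iff' (Equiv.Perm.mem_support.1 hx)).2
          (Equiv.Perm.SameCycle.refl _ _)
      · intro hx
        exact ⟨Equiv.Perm.mem_cycleFactorsFinset_support_le hc hx,
          (Equiv.Perm.cycle_is_cycleOf hx hc).symm⟩
    have hcyc : ∀ x ∈ c.support, minimalPeriod σ x = c.support.card := fun x hx => by
      have h := Equiv.Perm.isCycleOn_support_cycleOf σ x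
      rw [← Equiv.Perm.cycle_is_cycleOf hx hc] at h
      exact h.minimalPeriod_eq hx
    have hc0 : (c.support.card : ℚ) ≠ 0 := by
      exact_mod_cast (Finset.card_pos.2 hc'.1.nonempty_support).ne'
    rw [hset, Finset.sum_congr rfl fun x hx => by rw [hcyc x hx], Finset.sum_const,
      nsmul_eq_mul, mul_div_cancel₀ _ hc0]
    rfl
  -- `cycleType` records only cycles of length at least 2; the fixed points supply the parts equal
  -- to 1.
  rw [← Finset.sum_add_sum_compl σ.support, hsupp, Equiv.Perm.parts_partition,
    Multiset.map_add, Multiset.sum_add, Multiset.map_replicate, Multiset.sum_replicate,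
    ← Finset.card_compl, ← Finset.sum_const]
  congr 1
  refine Finset.sum_congr rfl fun x hx => ?_
  have : minimalPeriod σ x = 1 := by
    rw [minimalPeriod_eq_one_iff_isFixedPt]
    simpa [IsFixedPt] using hx
  simp [this]

open Function in
/-- The number of orbits of `σ` on pairs of points. -/
theorem Equiv.Perm.card_sameCycle_quotient_prodCongr {α : Type*} [Fintype α] [DecidableEq α]
    (σ : Equiv.Perm α) :
    Nat.card (Quotient (Equiv.Perm.SameCycle.setoid (Equiv.prodCongr σ σ : Equiv.Perm (α × α)))) =
      partitionBeta σ.partition := by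
  have key : (Nat.card (Quotient (Equiv.Perm.SameCycle.setoid
      (Equiv.prodCongr σ σ : Equiv.Perm (α × α)))) : ℚ) = partitionBeta σ.partition := by
    have hpos : ∀ x, (minimalPeriod σ x : ℚ) ≠ 0 := fun x => by
      exact_mod_cast (minimalPeriod_pos_of_mem_periodicPts
        (σ.injective.mem_periodicPts x)).ne'
    rw [Equiv.Perm.card_sameCycle_quotient, partitionBeta, Nat.cast_multiset_sum,
      Multiset.map_map]
    simp only [Function.comp_def, Nat.cast_multiset_sum, Multiset.map_map]
    simp only [Equiv.Perm.sum_parts_partition]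
    rw [Fintype.sum_prod_type]
    refine Finset.sum_congr rfl fun x _ => ?_
    rw [Finset.sum_div]
    refine Finset.sum_congr rfl fun y _ => ?_
    change ((minimalPeriod (Prod.map σ σ) (x, y) : ℕ) : ℚ)⁻¹ = _
    rw [minimalPeriod_prodMap]
    -- The pair (x, y) has period lcm(a, b), where a and b are the periods of x and y, and 1 /
    -- lcm(a, b) = gcd(a, b) / (ab).
    have h : (Nat.gcd (minimalPeriod σ x) (minimalPeriod σ y) : ℚ) *
        Nat.lcm (minimalPeriod σ x) (minimalPeriod σ y) =
        minimalPeriod σ x * minimalPeriod σ y := by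
      exact_mod_cast Nat.gcd_mul_lcm _ _
    have hl : (Nat.lcm (minimalPeriod σ x) (minimalPeriod σ y) : ℚ) ≠ 0 := fun h0 => by
      rw [h0, mul_zero] at h
      exact mul_ne_zero (hpos x) (hpos y) h.symm
    rw [div_div, mul_comm (minimalPeriod σ y : ℚ), eq_div_iff (mul_ne_zero (hpos x) (hpos y)), ← h,
      mul_comm, mul_assoc, mul_inv_cancel₀ hl, mul_one]
  exact_mod_cast key

/-! ### Permutations of a given cycle type. -/

/-- This is the count by `cycleType`, which ignores fixed points; the parts equal to 1 are split off
and contribute only the factorial of their multiplicity to the weight. -/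
theorem Equiv.Perm.card_partition_mul_weight {α : Type*} [Fintype α] [DecidableEq α]
    (l : (Fintype.card α).Partition) :
    (Finset.univ.filter fun σ : Equiv.Perm α => σ.partition = l).card * partitionWeight l =
      (Fintype.card α).factorial := by
  set m := l.parts.filter (2 ≤ ·) with hm
  have hparts : l.parts = m + Multiset.replicate (l.parts.count 1) 1 := by
    rw [← Multiset.filter_eq' l.parts 1, hm]
    conv_lhs => rw [← Multiset.filter_add_not (2 ≤ ·) l.parts]
    congr 1
    refine Multiset.filter_congr fun a ha => ?_
    have := l.parts_pos ha
    omega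
  have hsum : m.sum + l.parts.count 1 = Fintype.card α := by
    have h := l.parts_sum
    rw [hparts, Multiset.sum_add, Multiset.sum_replicate, smul_eq_mul, mul_one] at h
    exact h
  have hpart : ∀ σ : Equiv.Perm α, σ.partition = l ↔ σ.cycleType = m := fun σ => by
    constructor
    · rintro rfl
      exact Equiv.Perm.filter_parts_partition_eq_cycleType.symm
    · intro h
      rw [Nat.Partition.ext_iff, Equiv.Perm.parts_partition, hparts, ← Equiv.Perm.sum_cycleType, h]
      congr 2
      omega
  have hm2 : ∀ a ∈ m, 2 ≤ a := fun a ha => (Multiset.mem_filter.1 ha).2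
  have h := Equiv.Perm.card_of_cycleType_mul_eq α m
  rw [if_pos ⟨by omega, hm2⟩] at h
  simp only [hpart]
  rw [← h]
  congr 1
  have h1m : (1 : ℕ) ∉ m := fun h1 => absurd (hm2 1 h1) (by norm_num)
  have hcount : ∀ a ∈ m.toFinset, l.parts.count a = m.count a := fun a ha => by
    rw [hm, Multiset.count_filter_of_pos (hm2 a (Multiset.mem_toFinset.1 ha))]
  have hsub : l.parts.toFinset ⊆ insert 1 m.toFinset := fun a ha => by
    rw [Multiset.mem_toFinset, hparts, Multiset.mem_add] at ha
    rcases ha with ha | ha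
    · exact Finset.mem_insert_of_mem (Multiset.mem_toFinset.2 ha)
    · exact Finset.mem_insert.2 (Or.inl (Multiset.eq_of_mem_replicate ha))
  rw [partitionWeight, Finset.prod_subset hsub fun a _ ha => by
      rw [Multiset.count_eq_zero.2 (fun h => ha (Multiset.mem_toFinset.2 h))]; simp,
    Finset.prod_insert (fun h => h1m (Multiset.mem_toFinset.1 h)), one_pow, one_mul,
    Finset.prod_congr rfl fun a ha => by rw [hcount a ha], Finset.prod_mul_distrib,
    ← Finset.prod_multiset_count, show Fintype.card α - m.sum = l.parts.count 1 by omega, mul_assoc]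

/-- Averaging a function of the cycle type over the symmetric group. -/
theorem Equiv.Perm.sum_partition {α : Type*} [Fintype α] [DecidableEq α]
    (F : (Fintype.card α).Partition → ℚ) :
    ∑ σ : Equiv.Perm α, F σ.partition =
      (Fintype.card α).factorial * ∑ l, F l / partitionWeight l := by
  rw [← Finset.sum_fiberwise_of_maps_to (g := fun σ : Equiv.Perm α => σ.partition)
    (t := Finset.univ) fun x _ => Finset.mem_univ _, Finset.mul_sum]
  refine Finset.sum_congr rfl fun l _ => ?_
  have h := Equiv.Perm.card_partition_mul_weight (α := α) l
  have hw : (partitionWeight l : ℚ) ≠ 0 := fun h0 => by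
    rw [Nat.cast_eq_zero.1 h0, mul_zero] at h
    exact Nat.factorial_ne_zero _ h.symm
  rw [Finset.sum_congr rfl fun σ hσ => by rw [(Finset.mem_filter.1 hσ).2], Finset.sum_const,
    nsmul_eq_mul, ← h]
  push_cast
  field_simp

/-- Needed to let a multiplication on A × A descend to the orbits on pairs. -/
theorem Equiv.Perm.SameCycle.apply_eq_of_invariant {α β : Type*} {σ : Equiv.Perm α} {F : α → β}
    (hF : ∀ x, F (σ x) = F x) {x y : α} (h : σ.SameCycle x y) : F x = F y := by
  have hnat : ∀ (n : ℕ) (x : α), F ((σ ^ n) x) = F x := by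
    intro n
    induction n with
    | zero => intro x; rfl
    | succ n ih => intro x; rw [pow_succ, Equiv.Perm.mul_apply, ih, hF]
  obtain ⟨i, rfl⟩ := h
  obtain ⟨n, rfl | rfl⟩ := i.eq_nat_or_neg
  · rw [zpow_natCast, hnat]
  · have := hnat n ((σ ^ (-n : ℤ)) x)
    rw [← this, zpow_neg, zpow_natCast, ← Equiv.Perm.mul_apply, mul_inv_cancel, Equiv.Perm.one_apply]

/-! ### 3-nilpotent semigroups as surjections from pair orbits. -/

/-- `g` is an automorphism of `S` that fixes every product. -/
def FixesProducts {α : Type*} (S : Semigroup α) (g : Equiv.Perm α) : Prop :=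
  ∀ x y : α, g (x * y) = x * y ∧ g x * g y = x * y

/-- The orbits of a permutation on pairs of points. -/
abbrev PairOrbits {α : Type*} (σ : Equiv.Perm α) : Type _ :=
  Quotient (Equiv.Perm.SameCycle.setoid (Equiv.prodCongr σ σ : Equiv.Perm (α × α)))

section Data

variable {α : Type*} [DecidableEq α] (A : Finset α)

/-- The product of two elements of `A` is given by `f` and every other product is `z`. -/
def nilpotentMul (z : {x // x ∉ A}) (f : A × A → {x // x ∉ A}) (x y : α) : α :=
  if h : x ∈ A ∧ y ∈ A then f (⟨x, h.1⟩, ⟨y, h.2⟩) else z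

theorem nilpotentMul_of_mem (z : {x // x ∉ A}) (f : A × A → {x // x ∉ A})
    (x y : A) : nilpotentMul A z f x y = f (x, y) :=
  dif_pos ⟨x.2, y.2⟩

theorem nilpotentMul_of_not_mem (z : {x // x ∉ A}) (f : A × A → {x // x ∉ A})
    {x y : α} (h : ¬(x ∈ A ∧ y ∈ A)) : nilpotentMul A z f x y = z :=
  dif_neg h

theorem nilpotentMul_not_mem (z : {x // x ∉ A}) (f : A × A → {x // x ∉ A})
    (x y : α) : nilpotentMul A z f x y ∉ A := by
  by_cases h : x ∈ A ∧ y ∈ A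
  · rw [nilpotentMul_of_mem A z f ⟨x, h.1⟩ ⟨y, h.2⟩]
    exact (f _).2
  · rw [nilpotentMul_of_not_mem A z f h]
    exact z.2

/-- Since no value of `nilpotentMul` lies in `A`, all products of three elements are `z`. -/
@[reducible]
def Semigroup.ofNilpotentMul (z : {x // x ∉ A}) (f : A × A → {x // x ∉ A}) : Semigroup α where
  mul := nilpotentMul A z f
  mul_assoc x y w :=
    (nilpotentMul_of_not_mem A z f fun h => nilpotentMul_not_mem A z f x y h.1).trans
      (nilpotentMul_of_not_mem A z f fun h => nilpotentMul_not_mem A z f y w h.2).symm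

/-- The semigroup built from a map on the pair orbits of `σ`. -/
@[reducible]
def semigroupOfPairOrbits {σ : Equiv.Perm A} (h : Option (PairOrbits σ) → {x // x ∉ A}) :
    Semigroup α :=
  Semigroup.ofNilpotentMul A (h none) fun p => h (some (Quotient.mk _ p))

variable {A}

theorem productSet_semigroupOfPairOrbits {σ : Equiv.Perm A}
    {h : Option (PairOrbits σ) → {x // x ∉ A}} (hh : Function.Surjective h) :
    @productSet α (semigroupOfPairOrbits A h) = (A : Set α)ᶜ := by
  ext w
  constructor
  · rintro ⟨⟨x, y⟩, rfl⟩
    exact nilpotentMul_not_mem A _ _ x y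
  · intro hw
    obtain ⟨_ | q, hq⟩ := hh ⟨w, hw⟩
    -- Here w is the zero itself; it equals w * w because w lies outside A.
    · refine ⟨(w, w), ?_⟩
      refine (nilpotentMul_of_not_mem A _ _ fun h => hw h.1).trans ?_
      rw [hq]
    · induction q using Quotient.inductionOn with
      | h p =>
        refine ⟨(p.1, p.2), ?_⟩
        refine (nilpotentMul_of_mem A _ _ p.1 p.2).trans ?_
        rw [hq]

theorem isThreeNilpotent_semigroupOfPairOrbits {σ : Equiv.Perm A}
    {h : Option (PairOrbits σ) → {x // x ∉ A}} (hh : Function.Surjective h)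
    (hA : Nontrivial {x // x ∉ A}) :
    @IsThreeNilpotent α (semigroupOfPairOrbits A h) := by
  refine ⟨h none, fun a => ⟨?_, ?_⟩, fun a b c => ?_, ?_⟩
  · exact nilpotentMul_of_not_mem A _ _ fun H => (h none).2 H.1
  · exact nilpotentMul_of_not_mem A _ _ fun H => (h none).2 H.2
  · exact nilpotentMul_of_not_mem A _ _ fun H =>
      nilpotentMul_not_mem A _ _ a b H.1
  · obtain ⟨w, hw⟩ := exists_ne (h none)
    obtain ⟨_ | q, rfl⟩ := hh w
    · exact absurd rfl hw
    · induction q using Quotient.inductionOn with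
      | h p =>
        refine ⟨p.1, p.2, fun H => hw (Subtype.ext ?_)⟩
        exact (nilpotentMul_of_mem A _ _ p.1 p.2).symm.trans H

theorem fixesProducts_semigroupOfPairOrbits {σ : Equiv.Perm A}
    (h : Option (PairOrbits σ) → {x // x ∉ A}) :
    FixesProducts (semigroupOfPairOrbits A h) (Equiv.Perm.ofSubtype σ) := by
  intro x y
  refine ⟨Equiv.Perm.ofSubtype_apply_of_not_mem σ
    (nilpotentMul_not_mem A _ _ x y), ?_⟩
  by_cases hxy : x ∈ A ∧ y ∈ A
  · rw [Equiv.Perm.ofSubtype_apply_of_mem σ hxy.1, Equiv.Perm.ofSubtype_apply_of_mem σ hxy.2]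
    refine (nilpotentMul_of_mem A _ _ _ _).trans
      (Eq.trans ?_ (nilpotentMul_of_mem A _ _ ⟨x, hxy.1⟩ ⟨y, hxy.2⟩).symm)
    congr 3
    apply Quotient.sound
    exact Equiv.Perm.sameCycle_apply_left.2 (Equiv.Perm.SameCycle.refl
      (Equiv.prodCongr σ σ : Equiv.Perm (A × A)) (⟨x, hxy.1⟩, ⟨y, hxy.2⟩))
  · refine (nilpotentMul_of_not_mem A _ _ ?_).trans
      (nilpotentMul_of_not_mem A _ _ hxy).symm
    have hmem : ∀ w, Equiv.Perm.ofSubtype σ w ∈ A ↔ w ∈ A := fun w =>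
      Equiv.Perm.ofSubtype_apply_mem_iff_mem σ w
    rwa [hmem, hmem]

theorem semigroupOfPairOrbits_injective {σ : Equiv.Perm A} :
    Function.Injective (semigroupOfPairOrbits A (σ := σ)) := by
  intro h h' H
  have hmul : ∀ x y, (semigroupOfPairOrbits A h).mul x y =
      (semigroupOfPairOrbits A h').mul x y := fun x y => by rw [H]
  funext q
  rcases q with _ | q
  · apply Subtype.ext
    -- The zero lies outside A, so its square is the default value in both semigroups.
    have hn : ¬(((h none : α) ∈ A) ∧ (h none : α) ∈ A) := fun H => (h none).2 H.1
    exact (nilpotentMul_of_not_mem A _ _ hn).symm.trans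
      ((hmul _ _).trans (nilpotentMul_of_not_mem A _ _ hn))
  · induction q using Quotient.inductionOn with
    | h p =>
      apply Subtype.ext
      exact (nilpotentMul_of_mem A _ _ p.1 p.2).symm.trans
        ((hmul _ _).trans (nilpotentMul_of_mem A _ _ p.1 p.2))

/-- Every 3-nilpotent semigroup, with an automorphism fixing all products, arises from a
permutation of the non-products and a map on its pair orbits. -/
theorem exists_semigroupOfPairOrbits [S : Semigroup α] {g : Equiv.Perm α}
    (hS : IsThreeNilpotent α) (hg : FixesProducts S g) (hA : productSet α = (A : Set α)ᶜ) :
    ∃ (σ : Equiv.Perm A) (h : Option (PairOrbits σ) → {x // x ∉ A}), Function.Surjective h ∧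
      Equiv.Perm.ofSubtype σ = g ∧ semigroupOfPairOrbits A h = S := by
  obtain ⟨z, hz, hz3, -⟩ := hS
  have hprod : ∀ x, x ∉ A ↔ ∃ a b, a * b = x := fun x => by
    have : x ∈ productSet α ↔ x ∉ A := by rw [hA]; rfl
    rw [← this]
    exact ⟨fun ⟨p, hp⟩ => ⟨p.1, p.2, hp⟩, fun ⟨a, b, h⟩ => ⟨(a, b), h⟩⟩
  have hfix : ∀ x, x ∉ A → g x = x := fun x hx => by
    obtain ⟨a, b, rfl⟩ := (hprod x).1 hx
    exact (hg a b).1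
  have hgA : ∀ x, g x ∈ A ↔ x ∈ A := fun x => by
    constructor
    · intro h
      by_contra hx
      rw [hfix x hx] at h
      exact hx h
    · intro hx
      by_contra h
      have := g.injective (hfix _ h)
      rw [this] at h
      exact h hx
  let f : A × A → {x // x ∉ A} := fun p => ⟨p.1 * p.2, (hprod _).2 ⟨_, _, rfl⟩⟩
  have hzA : z ∉ A := (hprod z).2 ⟨z, z, (hz z).1⟩
  let h : Option (PairOrbits (g.subtypePerm hgA)) → {x // x ∉ A} := fun o =>
    o.elim ⟨z, hzA⟩ (Quotient.lift f fun p q hpq =>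
      Equiv.Perm.SameCycle.apply_eq_of_invariant
        (fun p => Subtype.ext (hg p.1 p.2).2) hpq)
  refine ⟨g.subtypePerm hgA, h, fun w => ?_, ?_, ?_⟩
  · by_cases hw : w = ⟨z, hzA⟩
    · exact ⟨none, hw.symm⟩
    -- A factor of a nonzero product cannot itself be a product, since triple products vanish; hence
    -- a and b lie in A.
    · obtain ⟨a, b, hab⟩ := (hprod w.1).1 w.2
      have ha : a ∈ A := by
        by_contra ha
        obtain ⟨c, d, rfl⟩ := (hprod a).1 ha
        exact hw (Subtype.ext (hab.symm.trans (hz3 c d b)))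
      have hb : b ∈ A := by
        by_contra hb
        obtain ⟨c, d, rfl⟩ := (hprod b).1 hb
        exact hw (Subtype.ext (hab.symm.trans ((mul_assoc a c d).symm.trans (hz3 a c d))))
      exact ⟨some (Quotient.mk _ (⟨a, ha⟩, ⟨b, hb⟩)), Subtype.ext hab⟩
  · exact Equiv.Perm.ofSubtype_subtypePerm hgA fun x hx => by
      by_contra h
      exact hx (hfix x h)
  · refine Semigroup.ext (funext fun x => funext fun y => ?_)
    by_cases hxy : x ∈ A ∧ y ∈ A
    · exact nilpotentMul_of_mem A _ _ ⟨x, hxy.1⟩ ⟨y, hxy.2⟩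
    · refine (nilpotentMul_of_not_mem A _ _ hxy).trans ?_
      change z = x * y
      by_cases hx : x ∈ A
      · obtain ⟨c, d, rfl⟩ := (hprod y).1 fun hy => hxy ⟨hx, hy⟩
        rw [← mul_assoc, hz3]
      · obtain ⟨c, d, rfl⟩ := (hprod x).1 hx
        rw [hz3]

/-- The pairs of a permutation and a 3-nilpotent semigroup all of whose products it fixes, where
`A` is the set of non-products. -/
theorem card_fixesProducts_fiber (hA : Nontrivial {x // x ∉ A}) :
    Nat.card {p : Equiv.Perm α × Semigroup α // (@IsThreeNilpotent α p.2 ∧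
      FixesProducts p.2 p.1) ∧ @productSet α p.2 = (A : Set α)ᶜ} =
    Nat.card (Σ σ : Equiv.Perm A,
      {h : Option (PairOrbits σ) → {x // x ∉ A} // Function.Surjective h}) := by
  symm
  refine Nat.card_eq_of_bijective (fun p => ⟨(Equiv.Perm.ofSubtype p.1,
    semigroupOfPairOrbits A p.2.1), ⟨isThreeNilpotent_semigroupOfPairOrbits p.2.2 hA,
    fixesProducts_semigroupOfPairOrbits p.2.1⟩, productSet_semigroupOfPairOrbits p.2.2⟩) ⟨?_, ?_⟩
  · rintro ⟨σ, h⟩ ⟨τ, k⟩ H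
    have H' := Prod.ext_iff.1 (congrArg Subtype.val H)
    obtain rfl : σ = τ := Equiv.Perm.ofSubtype_injective H'.1
    obtain rfl : h = k := Subtype.ext (semigroupOfPairOrbits_injective H'.2)
    rfl
  · rintro ⟨⟨g, S⟩, ⟨h3, hg⟩, hp⟩
    obtain ⟨σ, h, hh, rfl, rfl⟩ := exists_semigroupOfPairOrbits h3 hg hp
    exact ⟨⟨σ, h, hh⟩, rfl⟩

end Data

/-! ### Counting the pairs (g, S) with g fixing all products. -/

/-- `∑ S(β(λ) + 1, k) / w(λ)`, over the partitions `λ` of `r`. -/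
def weightedStirlingSum (r k : ℕ) : ℚ :=
  ∑ l : r.Partition, (Nat.stirlingSecond (partitionBeta l + 1) k : ℚ) / (partitionWeight l : ℚ)

/-- Disposes of the case of empty A: β of the empty partition is 0, and S(1, k) = 0 for k at least
2. -/
theorem weightedStirlingSum_zero {k : ℕ} (hk : 2 ≤ k) : weightedStirlingSum 0 k = 0 := by
  refine Finset.sum_eq_zero fun l _ => ?_
  have hl : l.parts = 0 := by
    refine Multiset.eq_zero_of_forall_notMem fun a ha => ?_
    have h1 := l.parts_pos ha
    have h2 := Multiset.single_le_sum (fun _ _ => Nat.zero_le _) a ha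
    rw [l.parts_sum] at h2
    omega
  rw [partitionBeta, hl, Multiset.map_zero, Multiset.sum_zero,
    Nat.stirlingSecond_eq_zero_of_lt (by omega), Nat.cast_zero, zero_div]

theorem card_pairOrbits_surjections {α : Type} [Fintype α] [DecidableEq α] (A : Finset α) :
    (Nat.card (Σ σ : Equiv.Perm A,
      {h : Option (PairOrbits σ) → {x // x ∉ A} // Function.Surjective h}) : ℚ) =
    (Fintype.card α - A.card).factorial * (A.card.factorial *
      weightedStirlingSum A.card (Fintype.card α - A.card)) := by
  have hcard : Nat.card {x // x ∉ A} = Fintype.card α - A.card := by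
    rw [Nat.card_eq_fintype_card, Fintype.card_subtype_compl, Fintype.card_coe]
  have hsum := Equiv.Perm.sum_partition (α := A)
    fun l => (Nat.stirlingSecond (partitionBeta l + 1) (Fintype.card α - A.card) : ℚ)
  have hA : Fintype.card A = A.card := Fintype.card_coe A
  rw [Nat.card_sigma]
  simp only [card_surjective, hcard, Finite.card_option,
    Equiv.Perm.card_sameCycle_quotient_prodCongr]
  push_cast
  rw [← Finset.mul_sum, hsum]
  change _ * (_ * weightedStirlingSum (Fintype.card A) _) = _
  rw [hA]

theorem IsThreeNilpotent.nontrivial_not_mem {α : Type*} [Semigroup α] (h : IsThreeNilpotent α)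
    {A : Finset α} (hA : productSet α = (A : Set α)ᶜ) : Nontrivial {x // x ∉ A} := by
  obtain ⟨z, hz, -, a, b, hab⟩ := h
  have hprod : ∀ x y : α, x * y ∉ A := fun x y => by
    have : x * y ∈ productSet α := ⟨(x, y), rfl⟩
    rw [hA] at this
    exact this
  have hzA : z ∉ A := by
    have := hprod z z
    rwa [(hz z).1] at this
  exact ⟨⟨⟨a * b, hprod a b⟩, ⟨z, hzA⟩, fun h => hab (congrArg Subtype.val h)⟩⟩

theorem card_fixesProducts (n : ℕ) :
    (Nat.card {p : Equiv.Perm (Fin n) × Semigroup (Fin n) //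
      @IsThreeNilpotent (Fin n) p.2 ∧ FixesProducts p.2 p.1} : ℚ) =
    n.factorial * ∑ r ∈ Finset.Icc 1 (n - 2), weightedStirlingSum r (n - r) := by
  classical
  let nonProducts : {p : Equiv.Perm (Fin n) × Semigroup (Fin n) //
      @IsThreeNilpotent (Fin n) p.2 ∧ FixesProducts p.2 p.1} → Finset (Fin n) :=
    fun p => (@productSet (Fin n) p.1.2)ᶜ.toFinset
  have hfib : ∀ A : Finset (Fin n), (Nat.card {p // nonProducts p = A} : ℚ) =
      if 2 ≤ n - A.card then (n - A.card).factorial *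
        (A.card.factorial * weightedStirlingSum A.card (n - A.card)) else 0 := by
    intro A
    have hiff : ∀ p, nonProducts p = A ↔ @productSet (Fin n) p.1.2 = (A : Set (Fin n))ᶜ := by
      intro p
      rw [← Finset.coe_inj, Set.coe_toFinset, compl_eq_comm, eq_comm]
    rw [Nat.card_congr (Equiv.subtypeEquivRight hiff), Nat.card_congr
      (Equiv.subtypeSubtypeEquivSubtypeInter _ fun p : Equiv.Perm (Fin n) × Semigroup (Fin n) =>
        @productSet (Fin n) p.2 = (A : Set (Fin n))ᶜ)]
    have hnt : Nontrivial {x // x ∉ A} ↔ 2 ≤ n - A.card := by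
      rw [← Fintype.one_lt_card_iff_nontrivial, Fintype.card_subtype_compl, Fintype.card_coe,
        Fintype.card_fin]
      rfl
    split_ifs with h
    · rw [card_fixesProducts_fiber (hnt.2 h), card_pairOrbits_surjections, Fintype.card_fin]
    · rw [Nat.cast_eq_zero]
      have : IsEmpty {p : Equiv.Perm (Fin n) × Semigroup (Fin n) //
          (@IsThreeNilpotent (Fin n) p.2 ∧ FixesProducts p.2 p.1) ∧
            @productSet (Fin n) p.2 = (A : Set (Fin n))ᶜ} :=
        ⟨fun p => h (hnt.1 (@IsThreeNilpotent.nontrivial_not_mem _ p.1.2 p.2.1.1 _ p.2.2))⟩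
      exact Nat.card_of_isEmpty
  rw [← Nat.card_congr (Equiv.sigmaFiberEquiv nonProducts), Nat.card_sigma, Nat.cast_sum]
  simp only [hfib]
  have hpow := Finset.sum_powerset_apply_card (fun r => if 2 ≤ n - r then ((n - r).factorial : ℚ) *
    (r.factorial * weightedStirlingSum r (n - r)) else 0) (x := (Finset.univ : Finset (Fin n)))
  rw [Finset.powerset_univ, Finset.card_univ, Fintype.card_fin] at hpow
  rw [hpow, Finset.mul_sum]
  symm
  refine Finset.sum_subset_zero_on_sdiff (fun r hr => ?_) (fun r hr => ?_) fun r hr => ?_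
  · rw [Finset.mem_Icc] at hr
    rw [Finset.mem_range]
    omega
  · rw [Finset.mem_sdiff, Finset.mem_Icc, Finset.mem_range] at hr
    split_ifs with h
    -- Given 2 ≤ n - r, the only size outside the range of summation is r = 0.
    · obtain rfl : r = 0 := by omega
      rw [weightedStirlingSum_zero h, mul_zero, mul_zero, smul_zero]
    · rw [smul_zero]
  · rw [Finset.mem_Icc] at hr
    rw [if_pos (by omega), nsmul_eq_mul,
      ← Nat.choose_mul_factorial_mul_factorial (show r ≤ n by omega)]
    push_cast
    ring

/-! ### Isomorphism invariance and Burnside's lemma. -/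

theorem IsThreeNilpotent.of_mulEquiv {S T : Type*} [Semigroup S] [Semigroup T] (e : S ≃* T)
    (h : IsThreeNilpotent S) : IsThreeNilpotent T := by
  obtain ⟨z, hz, hz3, a, b, hab⟩ := h
  refine ⟨e z, fun x => ?_, fun x y w => ?_, e a, e b, ?_⟩
  · obtain ⟨x, rfl⟩ := e.surjective x
    rw [← map_mul, ← map_mul, (hz x).1, (hz x).2]
    exact ⟨rfl, rfl⟩
  · obtain ⟨x, rfl⟩ := e.surjective x
    obtain ⟨y, rfl⟩ := e.surjective y
    obtain ⟨w, rfl⟩ := e.surjective w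
    rw [← map_mul, ← map_mul, hz3]
  · rw [← map_mul]
    exact fun h => hab (e.injective h)

/-- Conjugating by e turns an automorphism of T into one of S. -/
theorem IsSemirigid.of_mulEquiv {S T : Type*} [Semigroup S] [Semigroup T] (e : S ≃* T)
    (h : IsSemirigid S) : IsSemirigid T := by
  rintro φ _ ⟨⟨a, b⟩, rfl⟩
  have := h ((e.trans φ).trans e.symm) (e.symm a * e.symm b) ⟨(_, _), rfl⟩
  rw [← map_mul] at this
  simpa using e.symm.injective this

/-- Transport of a semigroup structure along a permutation. -/
@[reducible]
def Semigroup.transport {α : Type*} (g : Equiv.Perm α) (S : Semigroup α) : Semigroup α where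
  mul x y := g (S.mul (g.symm x) (g.symm y))
  mul_assoc x y z := by
    change g (S.mul (g.symm (g (S.mul (g.symm x) (g.symm y)))) (g.symm z)) =
      g (S.mul (g.symm x) (g.symm (g (S.mul (g.symm y) (g.symm z)))))
    rw [Equiv.symm_apply_apply, Equiv.symm_apply_apply]
    exact congrArg g (S.mul_assoc _ _ _)

/-- `g` as an isomorphism from `S` to its transport. -/
def Semigroup.transportEquiv {α : Type*} (g : Equiv.Perm α) (S : Semigroup α) :
    @MulEquiv α α S.toMul (Semigroup.transport g S).toMul :=
  @MulEquiv.mk α α S.toMul (Semigroup.transport g S).toMul g fun x y => by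
    change g (S.mul x y) = g (S.mul (g.symm (g x)) (g.symm (g y)))
    rw [Equiv.symm_apply_apply, Equiv.symm_apply_apply]

theorem Semigroup.transport_eq_iff {α : Type*} (g : Equiv.Perm α) (S T : Semigroup α) :
    Semigroup.transport g S = T ↔ ∀ x y, g (S.mul x y) = T.mul (g x) (g y) := by
  constructor
  · rintro rfl x y
    exact (@MulEquiv.map_mul α α S.toMul (Semigroup.transport g S).toMul
      (Semigroup.transportEquiv g S) x y)
  · intro h
    refine Semigroup.ext (funext fun x => funext fun y => ?_)
    change g (S.mul (g.symm x) (g.symm y)) = T.mul x y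
    rw [h, Equiv.apply_symm_apply, Equiv.apply_symm_apply]

theorem Semigroup.nonempty_mulEquiv_iff {α : Type*} (S T : Semigroup α) :
    Nonempty (@MulEquiv α α S.toMul T.toMul) ↔ ∃ g, Semigroup.transport g S = T := by
  constructor
  · rintro ⟨e⟩
    exact ⟨@MulEquiv.toEquiv α α S.toMul T.toMul e,
      (Semigroup.transport_eq_iff _ _ _).2 (@MulEquiv.map_mul' α α S.toMul T.toMul e)⟩
  · rintro ⟨g, rfl⟩
    exact ⟨Semigroup.transportEquiv g S⟩

/-- The symmetric group acting on the semigroup structures with an isomorphism-invariant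
property. -/
@[reducible]
def Semigroup.permAction {α : Type*} (P : Semigroup α → Prop)
    (hP : ∀ g S, P S → P (Semigroup.transport g S)) :
    MulAction (Equiv.Perm α) {S : Semigroup α // P S} where
  smul g S := ⟨Semigroup.transport g S.1, hP g S.1 S.2⟩
  one_smul _ := rfl
  mul_smul _ _ _ := rfl

/-- Burnside's lemma for semigroup structures on `Fin n`. -/
theorem card_isoSetoid_mul_factorial (n : ℕ) (P : Semigroup (Fin n) → Prop)
    (hP : ∀ g S, P S → P (Semigroup.transport g S)) :
    Nat.card (Quotient (isoSetoid n P)) * n.factorial =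
      Nat.card {p : Equiv.Perm (Fin n) × Semigroup (Fin n) // P p.2 ∧
        ∀ x y, p.1 (p.2.mul x y) = p.2.mul (p.1 x) (p.1 y)} := by
  let _ := Semigroup.permAction P hP
  have hrel : ∀ S T : {S : Semigroup (Fin n) // P S},
      (isoSetoid n P).r S T ↔ (MulAction.orbitRel (Equiv.Perm (Fin n)) _).r S T := by
    intro S T
    refine (Semigroup.nonempty_mulEquiv_iff S.1 T.1).trans ⟨?_, fun h => ?_⟩
    · rintro ⟨g, hg⟩
      exact (MulAction.orbitRel (Equiv.Perm (Fin n)) _).symm ⟨g, Subtype.ext hg⟩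
    · obtain ⟨g, hg⟩ := (MulAction.orbitRel (Equiv.Perm (Fin n)) _).symm h
      exact ⟨g, congrArg Subtype.val hg⟩
  have hq : Nat.card (Quotient (isoSetoid n P)) = Nat.card (MulAction.orbitRel.Quotient
      (Equiv.Perm (Fin n)) {S : Semigroup (Fin n) // P S}) :=
    Nat.card_congr (Quotient.congrRight hrel)
  have hn : n.factorial = Nat.card (Equiv.Perm (Fin n)) := by
    rw [Nat.card_perm, Nat.card_fin]
  rw [hq, hn, ← Nat.card_prod, ← Nat.card_congr
    (MulAction.sigmaFixedByEquivOrbitsProdGroup (Equiv.Perm (Fin n)) {S : Semigroup (Fin n) // P S})]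
  refine Nat.card_congr ⟨fun p => ⟨(p.1, p.2.1.1), p.2.1.2,
      (Semigroup.transport_eq_iff _ _ _).1 (congrArg Subtype.val p.2.2)⟩,
    fun p => ⟨p.1.1, ⟨p.1.2, p.2.1⟩, Subtype.ext ((Semigroup.transport_eq_iff _ _ _).2 p.2.2)⟩,
    fun _ => rfl, fun _ => rfl⟩

/-! ### The two inclusions and the resulting bounds. -/

theorem FixesProducts.map_mul {α : Type*} {S : Semigroup α} {g : Equiv.Perm α}
    (h : FixesProducts S g) (x y : α) : g (S.mul x y) = S.mul (g x) (g y) :=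
  (h x y).1.trans (h x y).2.symm

theorem IsSemirigid.fixesProducts {α : Type*} {S : Semigroup α} (h : IsSemirigid α)
    {g : Equiv.Perm α} (hg : ∀ x y, g (S.mul x y) = S.mul (g x) (g y)) : FixesProducts S g := by
  intro x y
  have hfix : g (x * y) = x * y := h { g with map_mul' := hg } (x * y) ⟨(x, y), rfl⟩
  exact ⟨hfix, (hg x y).symm.trans hfix⟩

theorem mainTheorem1 (n : ℕ) :
    (numSemirigidThreeNilpotent n : ℚ) ≤
        ∑ r ∈ Finset.Icc 1 (n - 2), ∑ l : r.Partition,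
          (Nat.stirlingSecond (partitionBeta l + 1) (n - r) : ℚ) / (partitionWeight l : ℚ) ∧
      ∑ r ∈ Finset.Icc 1 (n - 2), ∑ l : r.Partition,
          (Nat.stirlingSecond (partitionBeta l + 1) (n - r) : ℚ) / (partitionWeight l : ℚ) ≤
        (numThreeNilpotent n : ℚ) := by
  have hn : (0 : ℚ) < n.factorial := by exact_mod_cast n.factorial_pos
  have hM := card_fixesProducts n
  have hall := card_isoSetoid_mul_factorial n (fun S => @IsThreeNilpotent (Fin n) S)
    fun g S h => @IsThreeNilpotent.of_mulEquiv _ _ S (Semigroup.transport g S)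
      (Semigroup.transportEquiv g S) h
  have hsemi := card_isoSetoid_mul_factorial n
    (fun S => @IsThreeNilpotent (Fin n) S ∧ @IsSemirigid (Fin n) S)
    fun g S h => ⟨@IsThreeNilpotent.of_mulEquiv _ _ S (Semigroup.transport g S)
      (Semigroup.transportEquiv g S) h.1, @IsSemirigid.of_mulEquiv _ _ S (Semigroup.transport g S)
      (Semigroup.transportEquiv g S) h.2⟩
  constructor
  · refine le_of_mul_le_mul_right ?_ hn
    rw [mul_comm (∑ r ∈ _, _)]
    refine le_trans ?_ hM.le
    have hle : Nat.card {p : Equiv.Perm (Fin n) × Semigroup (Fin n) //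
        (@IsThreeNilpotent (Fin n) p.2 ∧ @IsSemirigid (Fin n) p.2) ∧
          ∀ x y, p.1 (p.2.mul x y) = p.2.mul (p.1 x) (p.1 y)} ≤
        Nat.card {p : Equiv.Perm (Fin n) × Semigroup (Fin n) //
          @IsThreeNilpotent (Fin n) p.2 ∧ FixesProducts p.2 p.1} :=
      Nat.card_le_card_of_injective
        (Subtype.map id fun p hp => ⟨hp.1.1, IsSemirigid.fixesProducts hp.1.2 hp.2⟩)
        (Subtype.map_injective _ Function.injective_id)
    exact_mod_cast hsemi.le.trans hle
  · refine le_of_mul_le_mul_right ?_ hn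
    rw [mul_comm (∑ r ∈ _, _)]
    refine hM.ge.trans ?_
    have hle : Nat.card {p : Equiv.Perm (Fin n) × Semigroup (Fin n) //
          @IsThreeNilpotent (Fin n) p.2 ∧ FixesProducts p.2 p.1} ≤
        Nat.card {p : Equiv.Perm (Fin n) × Semigroup (Fin n) // @IsThreeNilpotent (Fin n) p.2 ∧
          ∀ x y, p.1 (p.2.mul x y) = p.2.mul (p.1 x) (p.1 y)} :=
      Nat.card_le_card_of_injective (Subtype.map id fun p hp => ⟨hp.1, hp.2.map_mul⟩)
        (Subtype.map_injective _ Function.injective_id)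
    exact_mod_cast hle.trans hall.ge
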